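/- Let $q = 2r$ with $r \ge 2$ an integer, and let $\lambda_q = 2\cos(\pi/q)$. For a finite sequence of integers $b_1,\dots,b_n$ (with $n \ge 0$), the Rosen continued fraction $[b_1,\dots,b_n]_q$ is the expression \[ b_1\lambda_q - \cfrac{1}{b_2\lambda_q - \cfrac{1}{\ddots - \cfrac{1}{b_n\lambda_q}}}\,, \] whose value is computed in $\mathbb{R}\cup\{\infty\}$ with $1/0=\infty$, $1/\infty=0$ and $x-\infty=\infty$ for real $x$; the empty continued fraction ($n=0$) has value $\infty$. It is called geodesic if every finite Rosen continued fraction $[c_1,\dots,c_m]_q$ (with $m\ge 0$ and integers $c_i$) that has the same value satisfies $m\ge n$. Write $1^{[d]}$ for $d$ consecutive terms equal to $1$. Then $[b_1,\dots,b_n]_q$ is geodesic if and only if the sequence $b_2,\dots,b_n$ (which is empty when $n \le 1$) has all of the following three properties: (i) none of its terms is $0$; (ii) it contains no block of consecutive terms equal to $1^{[r]}$ or to the termwise negative of $1^{[r]}$; (iii) for every integer $k\ge 1$, it contains no block of consecutive terms equal to \[ 1^{[r-1]},2,1^{[r-2]},2,1^{[r-2]},\dots,1^{[r-2]},2,1^{[r-1]}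 \] with exactly $k$ terms equal to $2$ (any two consecutive $2$s being separated by $1^{[r-2]}$), or to the termwise negative of this sequence. -/

import Mathlib

namespace Rosen

/-- `λ_q = 2 cos (π / q)`. -/
noncomputable def lam (q : ℕ) : ℝ := 2 * Real.cos (Real.pi / q)

open Classical in
/-- The map `z ↦ b λ_q - 1 / z` on `ℝ ∪ {∞}`, with `1 / ∞ = 0` and `1 / 0 = ∞`. -/
noncomputable def step (q : ℕ) (b : ℤ) : OnePoint ℝ → OnePoint ℝ
  | none => ((b * lam q : ℝ) : OnePoint ℝ)
  | some x => if x = 0 then OnePoint.infty else ((b * lam q - 1 / x : ℝ) : OnePoint ℝ)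

/-- The value in `ℝ ∪ {∞}` of the finite Rosen continued fraction `[b₁, …, bₙ]_q`. The empty
continued fraction, which corresponds to the path of length zero at `∞`, has value `∞`, so that
`[b₁]_q` has value `b₁ λ_q`. -/
noncomputable def value (q : ℕ) : List ℤ → OnePoint ℝ
  | [] => OnePoint.infty
  | b :: l => step q b (value q l)

/-- `[b₁, …, bₙ]_q` is geodesic: every Rosen continued fraction expansion of its value has at least
`n` terms. -/
def IsGeodesic (q : ℕ) (b : List ℤ) : Prop :=
  ∀ c : List ℤ, value q c = value q b → b.length ≤ c.length

/-- The sequence `1^[r-1], 2, 1^[r-2], 2, 1^[r-2], …, 1^[r-2], 2, 1^[r-1]` with `k + 1` terms equal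
to `2` (for `r ≥ 2`). -/
def longBlock (r k : ℕ) : List ℤ :=
  List.replicate (r - 1) 1 ++ [2]
    ++ (List.replicate k (List.replicate (r - 2) 1 ++ [2])).flatten
    ++ List.replicate (r - 1) 1

/-- One of the sequences `x₁, …, xₘ` and `-x₁, …, -xₘ` occurs as a block of consecutive terms
of `l`. -/
def ContainsPM (l x : List ℤ) : Prop :=
  x <:+: l ∨ x.map (fun t => -t) <:+: l

end Rosen

/-!
Write `r = n + 2`. The maps `z ↦ b λ - 1 / z` move along the vertices of a tree of `q`-gons, and going
around one `q`-gon is a rotation: `z ↦ λ - 1 / z` has order `q` (`iterate_step_one`, seen in an angular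
coordinate in which the map is a translation by `π / q`). Hence the flip `value_flip`: the sequences
`a, 1^[k], m, …` and `a - 1, (-1)^[q-k-2], m - 1, …` have the same value. For `k = r - 1` the flip keeps
the length, for `k = r` it saves two terms.

All positive forbidden blocks have the form `1, (1^[r-2], 2)^k, 1^[r-1]` with `k ≥ 0`, the case `k = 0`
being `1^[r]`; see `Critical` and `Reduced`. In a sequence that is not reduced, flips of arcs of length
`r - 1` push the surplus turn to the end of the block, where a flip with `k = r` shortens it
(`exists_shorter_of_not_reduced`). So geodesics are reduced.

Conversely, two reduced sequences with the same value have the same length (`length_eq_of_value_eq`).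
The reciprocal value of a reduced tail lies in `[-1, 1]` and is smaller than `λ / 2` unless the tail
begins with `1^[r-1]` (`recip_bounds`). As `λ > 1`, the first terms of the two sequences differ by at
most one. If they differ, one of the two tails begins with `1^[r-1]` or its negative, and a flip, which
preserves reducedness (`Reduced.flip`), makes the first terms agree. They can then be removed, and
induction applies. Since a shortest sequence with a given value is reduced, every reduced sequence is
geodesic.
-/

namespace Rosen

/-! ### Algebra of the generating maps -/

lemma step_infty (q : ℕ) (b : ℤ) : step q b OnePoint.infty = ((b * lam q : ℝ) : OnePoint ℝ) := rfl

lemma step_zero_arg (q : ℕ) (b : ℤ) : step q b ((0 : ℝ) : OnePoint ℝ) = OnePoint.infty :=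
  if_pos rfl

lemma step_coe (q : ℕ) (b : ℤ) {x : ℝ} (hx : x ≠ 0) :
    step q b (x : OnePoint ℝ) = ((b * lam q - 1 / x : ℝ) : OnePoint ℝ) :=
  if_neg hx

/-- The composition law of the translations by multiples of `λ_q`. -/
lemma step_step_zero_step (q : ℕ) (a m : ℤ) (x : OnePoint ℝ) :
    step q a (step q 0 (step q m x)) = step q (a + m) x := by
  have key : ∀ y : ℝ, step q a (step q 0 (y : OnePoint ℝ)) = ((a * lam q + y : ℝ) : OnePoint ℝ) := by
    intro y
    by_cases hy : y = 0
    · subst hy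
      rw [step_zero_arg, step_infty, add_zero]
    · have h1 : ((0 : ℤ) * lam q - 1 / y : ℝ) ≠ 0 := by simpa using hy
      rw [step_coe q 0 hy, step_coe q a h1]
      congr 1
      simp
  induction x using OnePoint.rec with
  | infty =>
    rw [step_infty, step_infty, key]
    push_cast
    ring_nf
  | coe x =>
    by_cases hx : x = 0
    · subst hx
      rw [step_zero_arg, step_zero_arg, step_infty]
      simp [step_zero_arg]
    · rw [step_coe q m hx, step_coe q _ hx, key]
      push_cast
      ring_nf

lemma step_zero_step_zero (q : ℕ) (x : OnePoint ℝ) : step q 0 (step q 0 x) = x := by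
  induction x using OnePoint.rec with
  | infty => rw [step_infty]; simp [step_zero_arg]
  | coe x =>
    by_cases hx : x = 0
    · subst hx
      rw [step_zero_arg, step_infty]; simp
    · have h1 : ((0 : ℤ) * lam q - 1 / x : ℝ) ≠ 0 := by simpa using hx
      rw [step_coe q 0 hx, step_coe q 0 h1]
      simp

lemma step_injective (q : ℕ) (b : ℤ) : Function.Injective (step q b) := by
  have h : Function.LeftInverse (fun y => step q 0 (step q (-b) (step q 0 y))) (step q b) := by
    intro x
    simp only [step_step_zero_step, neg_add_cancel, step_zero_step_zero]
  exact h.injective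

/-- The point of the projective line with angular coordinate `α`. In this coordinate the map
`z ↦ λ_q - 1 / z` is the translation by `π / q`. -/
noncomputable def circlePoint (q : ℕ) (α : ℝ) : OnePoint ℝ :=
  if Real.sin α = 0 then OnePoint.infty
  else ((Real.sin (α + Real.pi / q) / Real.sin α : ℝ) : OnePoint ℝ)

lemma angle_pos {q : ℕ} (hq : 4 ≤ q) : 0 < Real.pi / q := by
  have : (0 : ℝ) < q := by exact_mod_cast (by omega : 0 < q)
  exact div_pos Real.pi_pos this

lemma angle_le {q : ℕ} (hq : 4 ≤ q) : Real.pi / q ≤ Real.pi / 4 := by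
  have : (4 : ℝ) ≤ q := by exact_mod_cast hq
  exact div_le_div_of_nonneg_left Real.pi_pos.le (by norm_num) this

lemma sin_angle_pos {q : ℕ} (hq : 4 ≤ q) : 0 < Real.sin (Real.pi / q) :=
  Real.sin_pos_of_pos_of_lt_pi (angle_pos hq) (by linarith [angle_le hq, Real.pi_pos])

/-- The addition formula behind the action of `z ↦ λ_q - 1 / z` in angular coordinates. -/
lemma lam_mul_sin (q : ℕ) (α : ℝ) :
    lam q * Real.sin (α + Real.pi / q) =
      Real.sin (α + Real.pi / q + Real.pi / q) + Real.sin α := by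
  have h := Real.sin_sub (α + Real.pi / q) (Real.pi / q)
  rw [add_sub_cancel_right] at h
  rw [Real.sin_add (α + Real.pi / q), h, lam]
  ring

lemma circlePoint_surjective {q : ℕ} (hq : 4 ≤ q) : Function.Surjective (circlePoint q) := by
  intro x
  induction x using OnePoint.rec with
  | infty => exact ⟨0, by simp [circlePoint]⟩
  | coe x =>
    set θ := Real.pi / q with hθ
    have hs : Real.sin θ ≠ 0 := (sin_angle_pos hq).ne'
    set y := (x - Real.cos θ) / Real.sin θ with hy
    refine ⟨Real.pi / 2 - Real.arctan y, ?_⟩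
    have hc : Real.cos (Real.arctan y) ≠ 0 := (Real.cos_arctan_pos y).ne'
    have ht : Real.sin (Real.arctan y) = y * Real.cos (Real.arctan y) := by
      rw [← Real.tan_mul_cos hc, Real.tan_arctan]
    rw [circlePoint, ← hθ, Real.sin_add, Real.sin_pi_div_two_sub, Real.cos_pi_div_two_sub, if_neg hc,
      ht]
    congr 1
    rw [hy]
    field_simp
    ring

lemma step_one_circlePoint {q : ℕ} (hq : 4 ≤ q) (α : ℝ) :
    step q 1 (circlePoint q α) = circlePoint q (α + Real.pi / q) := by
  have hs := (sin_angle_pos hq).ne'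
  have hl := lam_mul_sin q α
  by_cases h0 : Real.sin α = 0
  · have h1 : Real.sin (α + Real.pi / q) ≠ 0 := by
      have hc : Real.cos α ≠ 0 := by
        intro hc
        have := Real.sin_sq_add_cos_sq α
        simp [h0, hc] at this
      rw [Real.sin_add, h0]
      simp [hs, hc]
    rw [circlePoint, if_pos h0, step_infty, circlePoint, if_neg h1]
    congr 1
    rw [h0, add_zero] at hl
    rw [eq_div_iff h1, ← hl]
    simp
  · by_cases h1 : Real.sin (α + Real.pi / q) = 0
    · rw [circlePoint, if_neg h0, circlePoint, if_pos h1, h1, zero_div, step_zero_arg]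
    · rw [circlePoint, if_neg h0, circlePoint, if_neg h1, step_coe q 1 (div_ne_zero h1 h0)]
      congr 1
      rw [eq_div_iff h1, one_div_div, sub_mul, div_mul_cancel₀ _ h1]
      push_cast
      linarith

/-- The map `z ↦ λ_q - 1 / z` is a rotation of order `q`. -/
lemma iterate_step_one {q : ℕ} (hq : 4 ≤ q) (x : OnePoint ℝ) : (step q 1)^[q] x = x := by
  obtain ⟨α, rfl⟩ := circlePoint_surjective hq x
  have h : ∀ k : ℕ, (step q 1)^[k] (circlePoint q α) = circlePoint q (α + k * (Real.pi / q)) := by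
    intro k
    induction k with
    | zero => simp
    | succ k ih =>
      rw [Function.iterate_succ_apply', ih, step_one_circlePoint hq]
      push_cast
      ring_nf
  have hq0 : (q : ℝ) ≠ 0 := by
    have : q ≠ 0 := by omega
    exact_mod_cast this
  rw [h, mul_div_cancel₀ _ hq0]
  have e : α + Real.pi + Real.pi / q = (α + Real.pi / q) + Real.pi := by ring
  simp only [circlePoint, e, Real.sin_add_pi, neg_eq_zero, neg_div_neg_eq]

lemma iterate_step_one_comp (q k : ℕ) (x : OnePoint ℝ) :
    (step q 1)^[k] (step q 0 ((step q (-1))^[k] (step q 0 x))) = x := by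
  induction k with
  | zero => exact step_zero_step_zero q x
  | succ k ih =>
    rw [Function.iterate_succ_apply, Function.iterate_succ_apply' (step q (-1)),
      step_step_zero_step]
    exact ih

/-- The two ways around a `q`-gon: `k` positive turns amount to `q - k` negative ones. -/
lemma iterate_step_one_eq {q : ℕ} (hq : 4 ≤ q) {j k : ℕ} (hjk : j + k = q) (x : OnePoint ℝ) :
    (step q 1)^[k] x = step q 0 ((step q (-1))^[j] (step q 0 x)) := by
  have h := iterate_step_one hq (step q 0 ((step q (-1))^[j] (step q 0 x)))
  have hs : (step q 1)^[q] = (step q 1)^[k] ∘ (step q 1)^[j] := by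
    rw [← Function.iterate_add, Nat.add_comm, hjk]
  rw [hs, Function.comp_apply, iterate_step_one_comp] at h
  exact h

lemma value_append_replicate (q : ℕ) (b : ℤ) (k : ℕ) (l : List ℤ) :
    value q (List.replicate k b ++ l) = (step q b)^[k] (value q l) := by
  induction k with
  | zero => rfl
  | succ k ih =>
    rw [List.replicate_succ, List.cons_append, value, ih, Function.iterate_succ_apply']

lemma value_append_congr {q : ℕ} {l l' : List ℤ} (h : value q l = value q l') (p : List ℤ) :
    value q (p ++ l) = value q (p ++ l') := by
  induction p with
  | nil => exact h
  | cons a p ih => rw [List.cons_append, List.cons_append, value, value, ih]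

/-- Subtract one from the first term, if there is one. -/
def decHead : List ℤ → List ℤ
  | [] => []
  | m :: l => (m - 1) :: l

lemma length_decHead (l : List ℤ) : (decHead l).length = l.length := by
  cases l <;> rfl

/-- Replacing one arc of a `q`-gon by the complementary arc does not change the value. -/
lemma value_flip {q : ℕ} (hq : 4 ≤ q) {j k : ℕ} (hjk : j + k + 2 = q) (a : ℤ) (t : List ℤ) :
    value q (a :: (List.replicate k 1 ++ t)) =
      value q ((a - 1) :: (List.replicate j (-1) ++ decHead t)) := by
  have h1 : ∀ x, step q a (step q 0 (step q (-1) x)) = step q (a - 1) x := fun x => by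
    rw [step_step_zero_step, sub_eq_add_neg]
  have h2 : step q (-1) (step q 0 (value q t)) = value q (decHead t) := by
    cases t with
    | nil => simp [value, decHead, step_infty, step_zero_arg]
    | cons m l =>
      rw [value, decHead, value, step_step_zero_step]
      congr 1
      ring
  rw [value, value, value_append_replicate, value_append_replicate,
    iterate_step_one_eq hq (show (j + 1 + 1) + k = q by omega), Function.iterate_succ_apply,
    Function.iterate_succ_apply', h2, h1]

/-- A zero term can be removed by merging its neighbours; a final zero cancels the term before it. -/
lemma exists_shorter_of_zero (q : ℕ) (a : ℤ) (l : List ℤ) :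
    ∃ c : List ℤ, c.length < (a :: 0 :: l).length ∧ value q c = value q (a :: 0 :: l) := by
  cases l with
  | nil => exact ⟨[], by simp, by simp [value, step_infty, step_zero_arg]⟩
  | cons m l => exact ⟨(a + m) :: l, by simp, by simp only [value, step_step_zero_step]⟩

/-! ### Termwise negation -/

/-- Termwise negation of a sequence. -/
def negList (l : List ℤ) : List ℤ := l.map (fun t => -t)

@[simp] lemma negList_nil : negList [] = [] := rfl

@[simp] lemma negList_cons (x : ℤ) (l : List ℤ) : negList (x :: l) = -x :: negList l := rfl

@[simp] lemma negList_append (l l' : List ℤ) : negList (l ++ l') = negList l ++ negList l' :=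
  List.map_append

@[simp] lemma negList_replicate (k : ℕ) (x : ℤ) :
    negList (List.replicate k x) = List.replicate k (-x) := List.map_replicate

@[simp] lemma negList_negList (l : List ℤ) : negList (negList l) = l := by
  simp [negList]

@[simp] lemma length_negList (l : List ℤ) : (negList l).length = l.length := List.length_map _

lemma step_neg (q : ℕ) (b : ℤ) (x : OnePoint ℝ) :
    step q (-b) (OnePoint.map (fun y : ℝ => -y) x) = OnePoint.map (fun y : ℝ => -y) (step q b x) := by
  induction x using OnePoint.rec with
  | infty => simp [step_infty]
  | coe x =>
    by_cases hx : x = 0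
    · subst hx
      simp [step_zero_arg]
    · rw [OnePoint.map_some, step_coe q _ (neg_ne_zero.mpr hx), step_coe q _ hx, OnePoint.map_some]
      congr 1
      push_cast
      rw [div_neg]
      ring

lemma value_negList (q : ℕ) (l : List ℤ) :
    value q (negList l) = OnePoint.map (fun y : ℝ => -y) (value q l) := by
  induction l with
  | nil => rfl
  | cons b l ih => rw [negList_cons, value, value, ih, step_neg]

lemma value_negList_congr {q : ℕ} {l l' : List ℤ} (h : value q l = value q l') :
    value q (negList l) = value q (negList l') := by
  rw [value_negList, value_negList, h]

/-! ### Reduced sequences -/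

/-- With `r = n + 2`: the sequence begins with `(1^[r-2], 2)` repeated `k` times and then `1^[r-1]`,
for some `k ≥ 0`. The positive forbidden blocks, of both kinds, are exactly a `1` followed by such a
sequence. -/
inductive Critical (n : ℕ) : List ℤ → Prop
  | ones (l : List ℤ) : Critical n (List.replicate (n + 1) 1 ++ l)
  | two (l : List ℤ) : Critical n l → Critical n (List.replicate n 1 ++ 2 :: l)

/-- A sequence without zeros in which no forbidden block (for `r = n + 2`) occurs, phrased by
recursion on the position at which a block could start. -/
def Reduced (n : ℕ) : List ℤ → Prop
  | [] => True
  | x :: l => x ≠ 0 ∧ ¬(x = 1 ∧ Critical n l) ∧ ¬(x = -1 ∧ Critical n (negList l)) ∧ Reduced n l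

lemma Reduced.of_append {n : ℕ} {p l : List ℤ} (h : Reduced n (p ++ l)) : Reduced n l := by
  induction p with
  | nil => exact h
  | cons a p ih => exact ih h.2.2.2

lemma Reduced.tail {n : ℕ} {l : List ℤ} (h : Reduced n l) : Reduced n l.tail := by
  cases l with
  | nil => exact h
  | cons a l => exact h.2.2.2

lemma Reduced.negList {n : ℕ} {l : List ℤ} (h : Reduced n l) : Reduced n (negList l) := by
  induction l with
  | nil => exact h
  | cons a l ih =>
    obtain ⟨h0, h1, h2, h3⟩ := h
    rw [negList_cons]
    refine ⟨neg_ne_zero.mpr h0, fun H => h2 ⟨by linarith [H.1], H.2⟩, fun H => h1 ?_, ih h3⟩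
    rw [negList_negList] at H
    exact ⟨by linarith [H.1], H.2⟩

/-- The initial ones of a critical sequence cannot be interrupted before there are `r - 2` of them. -/
lemma Critical.eq_one {n i : ℕ} (hi : i < n) {y : ℤ} {t : List ℤ}
    (h : Critical n (List.replicate i 1 ++ y :: t)) : y = 1 := by
  generalize hl : List.replicate i 1 ++ y :: t = l at h
  have hy : l[i]? = some y := by simp [← hl]
  cases h with
  | ones l =>
    rw [List.getElem?_append_left (by simp; omega),
      List.getElem?_replicate_of_lt (by omega)] at hy
    exact (Option.some.inj hy).symm
  | two l =>
    rw [List.getElem?_append_left (by simpa using hi), List.getElem?_replicate_of_lt hi] at hy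
    exact (Option.some.inj hy).symm

lemma Critical.append {n : ℕ} {l : List ℤ} (h : Critical n l) (s : List ℤ) :
    Critical n (l ++ s) := by
  induction h with
  | ones l => rw [List.append_assoc]; exact .ones _
  | two l _ ih => rw [List.append_assoc]; exact .two _ ih

/-! ### Shortening sequences that are not reduced -/

/-- Flipping the polygons of a critical sequence one after the other moves the surplus turn to its
end, where `r` equal turns can be replaced by `r - 2` opposite ones. -/
lemma Critical.exists_shorter {q n : ℕ} (hq : q = 2 * (n + 2)) {l : List ℤ} (h : Critical n l) :
    ∀ a : ℤ, ∃ c : List ℤ,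
      c.length < (a :: 1 :: l).length ∧ value q c = value q (a :: 1 :: l) := by
  induction h with
  | ones l =>
    intro a
    refine ⟨(a - 1) :: (List.replicate n (-1) ++ decHead l), ?_, ?_⟩
    · simp [length_decHead]
    · exact (value_flip (k := n + 2) (by omega) (by omega) a l).symm
  | two l _ ih =>
    intro a
    obtain ⟨c, hc, hv⟩ := ih (-1)
    refine ⟨(a - 1) :: (List.replicate n (-1) ++ c), ?_, ?_⟩
    · simp at hc ⊢
      omega
    · have h1 := value_flip (q := q) (j := n + 1) (k := n + 1) (by omega) (by omega) a (2 :: l)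
      rw [List.replicate_succ' (a := (-1 : ℤ)), List.append_assoc] at h1
      exact (value_append_congr (value_append_congr hv (List.replicate n (-1))) [a - 1]).trans
        h1.symm

lemma exists_shorter_of_not_reduced {q n : ℕ} (hq : q = 2 * (n + 2)) {l : List ℤ}
    (h : ¬ Reduced n l) :
    ∀ a : ℤ, ∃ c : List ℤ, c.length < (a :: l).length ∧ value q c = value q (a :: l) := by
  induction l with
  | nil => exact absurd trivial h
  | cons x l ih =>
    intro a
    by_cases hl : Reduced n l
    · by_cases h0 : x = 0
      · subst h0
        exact exists_shorter_of_zero q a l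
      · by_cases h1 : x = 1 ∧ Critical n l
        · obtain ⟨rfl, hc⟩ := h1
          exact hc.exists_shorter hq a
        · have h2 : x = -1 ∧ Critical n (negList l) := by
            by_contra h2
            exact h ⟨h0, h1, h2, hl⟩
          obtain ⟨rfl, hc⟩ := h2
          obtain ⟨c, hc, hv⟩ := hc.exists_shorter hq (-a)
          refine ⟨negList c, by simpa using hc, ?_⟩
          simpa using value_negList_congr hv
    · obtain ⟨c, hc, hv⟩ := ih hl x
      exact ⟨a :: c, by simpa using hc, value_append_congr hv [a]⟩

lemma IsGeodesic.reduced_tail {q n : ℕ} (hq : q = 2 * (n + 2)) {b : List ℤ}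
    (h : IsGeodesic q b) : Reduced n b.tail := by
  by_contra hb
  cases b with
  | nil => exact hb trivial
  | cons a l =>
    obtain ⟨c, hc, hv⟩ := exists_shorter_of_not_reduced hq hb a
    exact (h c hv).not_gt hc

/-! ### Bounds for the values of reduced sequences -/

/-- The reciprocal of the value of a sequence. Division by zero does not occur for reduced
sequences. -/
noncomputable def recip (q : ℕ) : List ℤ → ℝ
  | [] => 0
  | b :: l => 1 / (b * lam q - recip q l)

lemma recip_negList (q : ℕ) (l : List ℤ) : recip q (negList l) = -recip q l := by
  induction l with
  | nil => simp [recip]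
  | cons b l ih =>
    rw [negList_cons, recip, recip, ih, ← div_neg]
    push_cast
    ring_nf

/-- The reciprocal of the point with angular coordinate `α`; it increases with `α`. -/
noncomputable def sinRatio (q : ℕ) (α : ℝ) : ℝ := Real.sin α / Real.sin (α + Real.pi / q)

lemma sinRatio_zero (q : ℕ) : sinRatio q 0 = 0 := by simp [sinRatio]

lemma sinRatio_lt {q : ℕ} (hq : 4 ≤ q) {α β : ℝ} (h0 : 0 ≤ α) (h : α < β)
    (hβ : β + Real.pi / q < Real.pi) : sinRatio q α < sinRatio q β := by
  have hθ := angle_pos hq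
  have hs := sin_angle_pos hq
  rw [sinRatio, sinRatio, div_lt_div_iff₀ (Real.sin_pos_of_pos_of_lt_pi (by linarith) (by linarith))
    (Real.sin_pos_of_pos_of_lt_pi (by linarith) (by linarith)), ← sub_pos]
  have h1 : Real.sin β * Real.sin (α + Real.pi / q) - Real.sin α * Real.sin (β + Real.pi / q)
      = Real.sin (Real.pi / q) * Real.sin (β - α) := by
    rw [Real.sin_add, Real.sin_add, Real.sin_sub]
    ring
  rw [h1]
  exact mul_pos hs (Real.sin_pos_of_pos_of_lt_pi (by linarith) (by linarith))

lemma sinRatio_le {q : ℕ} (hq : 4 ≤ q) {α β : ℝ} (h0 : 0 ≤ α) (h : α ≤ β)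
    (hβ : β + Real.pi / q < Real.pi) : sinRatio q α ≤ sinRatio q β := by
  rcases h.eq_or_lt with rfl | h
  · exact le_rfl
  · exact (sinRatio_lt hq h0 h hβ).le

/-- The map `ρ ↦ 1 / (λ - ρ)`, which is the effect of a term `1` on reciprocals, is a translation in
the angular coordinate. -/
lemma sinRatio_add {q : ℕ} (hq : 4 ≤ q) {α : ℝ} (h0 : 0 ≤ α)
    (hα : α + Real.pi / q + Real.pi / q < Real.pi) :
    0 < lam q - sinRatio q α ∧
      1 / (lam q - sinRatio q α) = sinRatio q (α + Real.pi / q) := by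
  have hθ := angle_pos hq
  have h1 : 0 < Real.sin (α + Real.pi / q) :=
    Real.sin_pos_of_pos_of_lt_pi (by linarith) (by linarith)
  have h2 : 0 < Real.sin (α + Real.pi / q + Real.pi / q) :=
    Real.sin_pos_of_pos_of_lt_pi (by linarith) (by linarith)
  have e : lam q - sinRatio q α =
      Real.sin (α + Real.pi / q + Real.pi / q) / Real.sin (α + Real.pi / q) := by
    rw [sinRatio, eq_div_iff h1.ne', sub_mul, lam_mul_sin, div_mul_cancel₀ _ h1.ne']
    ring
  rw [e]
  exact ⟨div_pos h2 h1, by rw [one_div_div]; rfl⟩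

/-- Prepending `j` terms `1` shifts upper bounds by `j` steps in the angular coordinate. -/
lemma recip_replicate {q : ℕ} (hq : 4 ≤ q) (t : List ℤ) {α : ℝ} (h0 : 0 ≤ α) (j : ℕ)
    (hj : α + j * (Real.pi / q) + Real.pi / q < Real.pi) :
    (recip q t ≤ sinRatio q α →
      recip q (List.replicate j 1 ++ t) ≤ sinRatio q (α + j * (Real.pi / q))) ∧
    (recip q t < sinRatio q α →
      recip q (List.replicate j 1 ++ t) < sinRatio q (α + j * (Real.pi / q))) := by
  have hθ := angle_pos hq
  induction j with
  | zero => simp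
  | succ j ih =>
    push_cast at hj ⊢
    have e : α + (j + 1) * (Real.pi / q) = α + j * (Real.pi / q) + Real.pi / q := by ring
    rw [e] at hj ⊢
    have hp : 0 ≤ α + j * (Real.pi / q) := by positivity
    obtain ⟨h1, h2⟩ := sinRatio_add hq hp hj
    obtain ⟨h3, h4⟩ := ih (by linarith)
    rw [List.replicate_succ, List.cons_append, recip, ← h2]
    push_cast
    rw [one_mul]
    exact ⟨fun h => one_div_le_one_div_of_le h1 (by linarith [h3 h]),
      fun h => one_div_lt_one_div_of_lt h1 (by linarith [h4 h])⟩

lemma one_lt_lam {q : ℕ} (hq : 4 ≤ q) : 1 < lam q := by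
  have hθ := angle_pos hq
  have h : Real.cos (Real.pi / 3) < Real.cos (Real.pi / q) :=
    Real.cos_lt_cos_of_nonneg_of_le_pi hθ.le (by linarith [Real.pi_pos])
      (by linarith [angle_le hq, Real.pi_pos])
  rw [Real.cos_pi_div_three] at h
  rw [lam]
  linarith

lemma sinRatio_angle {q : ℕ} (hq : 4 ≤ q) : sinRatio q (Real.pi / q) = 1 / lam q := by
  have := sinRatio_add hq le_rfl (by linarith [angle_le hq, angle_pos hq])
  rw [sinRatio_zero, sub_zero, zero_add] at this
  exact this.2.symm

lemma sinRatio_half_angle {q : ℕ} (hq : 4 ≤ q) :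
    sinRatio q (Real.pi / q / 2) = 1 / (lam q + 1) := by
  have hθ := angle_pos hq
  have hs : Real.sin (Real.pi / q / 2) ≠ 0 :=
    (Real.sin_pos_of_pos_of_lt_pi (by linarith) (by linarith [angle_le hq])).ne'
  have hl := lam_mul_sin q (-(Real.pi / q / 2))
  have e1 : -(Real.pi / q / 2) + Real.pi / q = Real.pi / q / 2 := by ring
  rw [e1, Real.sin_neg] at hl
  have e2 : Real.sin (Real.pi / q / 2 + Real.pi / q) = (lam q + 1) * Real.sin (Real.pi / q / 2) := by
    linarith
  have := one_lt_lam hq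
  rw [sinRatio, e2, div_mul_cancel_right₀ hs, one_div]

lemma angle_mul {q n : ℕ} (hq : q = 2 * (n + 2)) :
    (n : ℝ) * (Real.pi / q) = Real.pi / 2 - 2 * (Real.pi / q) := by
  have h : (q : ℝ) = 2 * (n + 2) := by rw [hq]; push_cast; ring
  have h0 : (n : ℝ) + 2 ≠ 0 := by positivity
  rw [h]
  field_simp
  ring

lemma sinRatio_eq_lam_div_two {q n : ℕ} (hq : q = 2 * (n + 2)) :
    sinRatio q ((n + 1) * (Real.pi / q)) = lam q / 2 := by
  have e : ((n : ℝ) + 1) * (Real.pi / q) = Real.pi / 2 - Real.pi / q := by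
    linarith [angle_mul hq]
  rw [e, sinRatio, sub_add_cancel, Real.sin_pi_div_two, Real.sin_pi_div_two_sub, lam]
  ring

lemma sinRatio_eq_one {q n : ℕ} (hq : q = 2 * (n + 2)) :
    sinRatio q (Real.pi / q / 2 + (n + 1) * (Real.pi / q)) = 1 := by
  have hq4 : 4 ≤ q := by omega
  have hθ := angle_pos hq4
  have e : Real.pi / q / 2 + ((n : ℝ) + 1) * (Real.pi / q) = Real.pi / 2 - Real.pi / q / 2 := by
    linarith [angle_mul hq]
  have e2 : Real.pi / 2 - Real.pi / q / 2 + Real.pi / q =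
      Real.pi - (Real.pi / 2 - Real.pi / q / 2) := by ring
  rw [e, sinRatio, e2, Real.sin_pi_sub]
  exact div_self (Real.sin_pos_of_pos_of_lt_pi (by linarith [angle_le hq4, Real.pi_pos])
    (by linarith [Real.pi_pos])).ne'

lemma sinRatio_eq_lam_sub_one {q n : ℕ} (hq : q = 2 * (n + 2)) :
    sinRatio q (Real.pi / q / 2 + n * (Real.pi / q)) = lam q - 1 := by
  have hq4 : 4 ≤ q := by omega
  have hθ := angle_pos hq4
  have hn := angle_mul hq
  have h := sinRatio_add (q := q) hq4 (α := Real.pi / q / 2 + n * (Real.pi / q)) (by positivity)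
    (by linarith [angle_le hq4, Real.pi_pos])
  have e : Real.pi / q / 2 + n * (Real.pi / q) + Real.pi / q =
      Real.pi / q / 2 + (n + 1) * (Real.pi / q) := by ring
  rw [e, sinRatio_eq_one hq, div_eq_one_iff_eq h.1.ne'] at h
  linarith [h.2]

lemma exists_leading_ones (l : List ℤ) :
    ∃ (j : ℕ) (t : List ℤ), l = List.replicate j 1 ++ t ∧ t.head? ≠ some 1 := by
  induction l with
  | nil => exact ⟨0, [], rfl, by simp⟩
  | cons x l ih =>
    by_cases hx : x = 1
    · obtain ⟨j, t, rfl, ht⟩ := ih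
      exact ⟨j + 1, t, by rw [hx]; rfl, ht⟩
    · exact ⟨0, x :: l, rfl, by simpa using hx⟩

/-- Let `l` be reduced and `r = n + 2`. Then its value `v` satisfies `1 / v ≤ 1`; moreover
`1 / v ≤ λ - 1` unless `l` is critical, and `1 / v < λ / 2` unless `l` begins with `1^[r-1]`. These
bounds have angular coordinates `(r - 1/2) π / q`, `(r - 3/2) π / q` and `(r - 1) π / q`. -/
lemma recip_bounds {q n : ℕ} (hq : q = 2 * (n + 2)) (l : List ℤ) (hl : Reduced n l) :
    recip q l ≤ 1 ∧ (¬ Critical n l → recip q l ≤ lam q - 1) ∧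
      (¬ List.replicate (n + 1) 1 <+: l → recip q l < lam q / 2) := by
  have hq4 : 4 ≤ q := by omega
  have hθ := angle_pos hq4
  have hθ4 := angle_le hq4
  have hn := angle_mul hq
  have hlam := one_lt_lam hq4
  have hpi := Real.pi_pos
  induction hlen : l.length using Nat.strong_induction_on generalizing l with
  | _ N ih =>
  obtain ⟨j, t, rfl, ht⟩ := exists_leading_ones l
  -- At most `r - 1` leading ones.
  have hj : j ≤ n + 1 := by
    by_contra hj
    obtain ⟨i, rfl⟩ : ∃ i, j = n + 2 + i := ⟨j - (n + 2), by omega⟩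
    rw [List.replicate_add, List.append_assoc] at hl
    exact hl.2.1 ⟨rfl, .ones _⟩
  have hjn : ¬ List.replicate (n + 1) (1 : ℤ) <+: List.replicate j 1 ++ t → j ≤ n := by
    intro h
    by_contra hj'
    obtain rfl : j = n + 1 := by omega
    exact h (List.prefix_append _ _)
  have hcj : ¬ Critical n (List.replicate j 1 ++ t) → j ≤ n := by
    intro h
    refine hjn fun ⟨s, hs⟩ => h ?_
    rw [← hs]
    exact .ones s
  have hmono : ∀ i k : ℕ, i ≤ k → (i : ℝ) * (Real.pi / q) ≤ k * (Real.pi / q) := fun i k hi =>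
    mul_le_mul_of_nonneg_right (by exact_mod_cast hi) hθ.le
  have hjn1 := hmono j (n + 1) hj
  push_cast at hjn1
  have hj0 : 0 ≤ (j : ℝ) * (Real.pi / q) := by positivity
  have hrt : Reduced n t := hl.of_append
  by_cases hpos : ∃ m γ, t = m :: γ ∧ 2 ≤ m
  · obtain ⟨m, γ, rfl, hm⟩ := hpos
    have ihγ := ih γ.length (by simp at hlen; omega) γ hrt.2.2.2 rfl
    have hm2 : (2 : ℝ) ≤ m := by exact_mod_cast hm
    have hml : 2 * lam q ≤ m * lam q := mul_le_mul_of_nonneg_right hm2 (by linarith)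
    -- The coordinate of the reciprocal is below one step, and below half a step unless `m = 2` is
    -- followed by a critical sequence.
    have ht1 : recip q (m :: γ) < sinRatio q (Real.pi / q) := by
      rw [sinRatio_angle hq4, recip]
      exact one_div_lt_one_div_of_lt (by linarith) (by linarith [ihγ.1])
    have ht2 : (m = 2 → ¬ Critical n γ) → recip q (m :: γ) ≤ sinRatio q (Real.pi / q / 2) := by
      intro hc
      rw [sinRatio_half_angle hq4, recip]
      refine one_div_le_one_div_of_le (by linarith) ?_
      rcases hm.eq_or_lt with h2 | h3
      · linarith [ihγ.2.1 (hc h2.symm)]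
      · have hm3 : (3 : ℝ) ≤ m := by exact_mod_cast h3
        have : 3 * lam q ≤ m * lam q := mul_le_mul_of_nonneg_right hm3 (by linarith)
        linarith [ihγ.1]
    have hle : ∀ i : ℕ, j ≤ i → i ≤ n + 1 → (j = i → m = 2 → ¬ Critical n γ) →
        recip q (List.replicate j 1 ++ m :: γ) ≤
          sinRatio q (Real.pi / q / 2 + i * (Real.pi / q)) := by
      intro i hi hin hc
      have h2 := hmono i (n + 1) hin
      push_cast at h2
      rcases hi.eq_or_lt with rfl | hi
      · exact (recip_replicate hq4 _ (by linarith) j (by linarith)).1 (ht2 (hc rfl))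
      · have h1 := hmono (j + 1) i hi
        push_cast at h1
        exact ((recip_replicate hq4 _ hθ.le j (by linarith)).1 ht1.le).trans
          (sinRatio_le hq4 (by linarith) (by linarith) (by linarith))
    refine ⟨?_, fun h => ?_, fun h => ?_⟩
    · have h1 := hle (n + 1) hj le_rfl ?_
      · push_cast at h1
        rwa [sinRatio_eq_one hq] at h1
      · rintro rfl rfl hc
        exact hl.2.1 ⟨rfl, .two _ hc⟩
    · have h1 := hle n (hcj h) (by omega) ?_
      · rwa [sinRatio_eq_lam_sub_one hq] at h1
      · rintro rfl rfl hc
        exact h (.two _ hc)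
    · rw [← sinRatio_eq_lam_div_two hq]
      have := hmono j n (hjn h)
      exact ((recip_replicate hq4 _ hθ.le j (by linarith)).2 ht1).trans_le
        (sinRatio_le hq4 (by linarith) (by linarith) (by linarith))
  -- If what follows the leading ones is empty or begins with a negative term, it has reciprocal `≤ 0`.
  · have ht0 : recip q t ≤ sinRatio q 0 := by
      rw [sinRatio_zero]
      cases t with
      | nil => exact le_rfl
      | cons m γ =>
        have hm : m ≤ -1 := by
          have h1 : m ≠ 1 := by simpa using ht
          have h2 : ¬ 2 ≤ m := fun h => hpos ⟨m, γ, rfl, h⟩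
          have := hrt.1
          omega
        have ihγ := (ih γ.length (by simp at hlen; omega) (negList γ) hrt.2.2.2.negList
          (by simp)).1
        rw [recip_negList] at ihγ
        have hm1 : (m : ℝ) ≤ -1 := by exact_mod_cast hm
        have : (m : ℝ) * lam q ≤ -1 * lam q := mul_le_mul_of_nonneg_right hm1 (by linarith)
        rw [recip]
        exact one_div_nonpos.mpr (by linarith)
    have hle := (recip_replicate hq4 t le_rfl j (by linarith)).1 ht0
    rw [zero_add] at hle
    refine ⟨?_, fun h => ?_, fun h => ?_⟩
    · rw [← sinRatio_eq_one hq]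
      exact hle.trans (sinRatio_le hq4 hj0 (by linarith) (by linarith))
    · rw [← sinRatio_eq_lam_sub_one hq]
      have := hmono j n (hcj h)
      exact hle.trans (sinRatio_le hq4 hj0 (by linarith) (by linarith))
    · rw [← sinRatio_eq_lam_div_two hq]
      have := hmono j n (hjn h)
      exact hle.trans_lt (sinRatio_lt hq4 hj0 (by linarith) (by linarith))

lemma abs_recip_le {q n : ℕ} (hq : q = 2 * (n + 2)) {l : List ℤ} (hl : Reduced n l) :
    |recip q l| ≤ 1 := by
  have h1 := (recip_bounds hq l hl).1
  have h2 := (recip_bounds hq _ hl.negList).1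
  rw [recip_negList] at h2
  exact abs_le.mpr ⟨by linarith, h1⟩

lemma replicate_prefix_of_recip {q n : ℕ} (hq : q = 2 * (n + 2)) {l : List ℤ} (hl : Reduced n l)
    (h : lam q / 2 ≤ recip q l) : List.replicate (n + 1) 1 <+: l := by
  by_contra hp
  linarith [(recip_bounds hq l hl).2.2 hp]

/-- No division by zero occurs in `recip` for a reduced sequence. -/
lemma denominator_ne_zero {q n : ℕ} (hq : q = 2 * (n + 2)) {b : ℤ} {l : List ℤ}
    (hl : Reduced n (b :: l)) : b * lam q - recip q l ≠ 0 := by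
  have h := abs_le.mp (abs_recip_le hq hl.2.2.2)
  have hlam := one_lt_lam (show 4 ≤ q by omega)
  rcases lt_or_gt_of_ne hl.1 with hb | hb
  · have hb1 : (b : ℝ) ≤ -1 := by exact_mod_cast (by omega : b ≤ -1)
    have := mul_le_mul_of_nonneg_right hb1 (by linarith : (0 : ℝ) ≤ lam q)
    exact ne_of_lt (by linarith)
  · have hb1 : (1 : ℝ) ≤ b := by exact_mod_cast (by omega : 1 ≤ b)
    have := mul_le_mul_of_nonneg_right hb1 (by linarith : (0 : ℝ) ≤ lam q)
    exact ne_of_gt (by linarith)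

lemma value_cons_eq {q n : ℕ} (hq : q = 2 * (n + 2)) {l : List ℤ} (hl : Reduced n l) (b : ℤ) :
    value q (b :: l) = ((b * lam q - recip q l : ℝ) : OnePoint ℝ) := by
  induction l generalizing b with
  | nil => simp [value, step_infty, recip]
  | cons m l ih =>
    rw [value, ih hl.2.2.2, step_coe q b (denominator_ne_zero hq hl), recip]

/-! ### Reduced sequences with the same value -/

/-- Flipping an arc of `r - 1` turns keeps the sequence reduced. A sequence `1^[r-1], t` becomes
`(-1)^[r-1], t'` with `t' = decHead t`; its first term is left out, since only the tail of a sequence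
has to be reduced. -/
lemma Reduced.flip {n : ℕ} {t : List ℤ} (h : Reduced n (List.replicate (n + 1) 1 ++ t)) :
    Reduced n (List.replicate n (-1) ++ decHead t) := by
  have ht : Reduced n (decHead t) := by
    have h' : Reduced n t := h.of_append
    cases t with
    | nil => trivial
    | cons m l =>
      have hm : m ≠ 1 := by
        rintro rfl
        refine h.2.1 ⟨rfl, ?_⟩
        have := Critical.ones (n := n) l
        rwa [List.replicate_succ', List.append_assoc] at this
      refine ⟨sub_ne_zero.mpr hm, fun H => ?_, fun H => h'.1 (by linarith [H.1]), h'.2.2.2⟩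
      obtain rfl : m = 2 := by linarith [H.1]
      exact h.2.1 ⟨rfl, .two _ H.2⟩
  have hi : ∀ i ≤ n, Reduced n (List.replicate i (-1) ++ decHead t) := by
    intro i
    induction i with
    | zero => exact fun _ => ht
    | succ i ih =>
      intro hin
      refine ⟨by norm_num, fun H => absurd H.1 (by norm_num), fun H => ?_, ih (by omega)⟩
      have hc : Critical n (Rosen.negList (List.replicate i (-1) ++ decHead t)) := H.2
      cases t with
      | nil =>
        simp only [decHead, List.append_nil, negList_replicate, neg_neg] at hc
        -- Padding by a term other than `1` shows that `1^[i]` is too short to be critical.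
        have := hc.append [0]
        exact absurd (this.eq_one hin) (by norm_num)
      | cons m l =>
        simp only [decHead, negList_append, negList_cons, negList_replicate, neg_neg] at hc
        have hm : m ≠ 0 := (h.of_append : Reduced n (m :: l)).1
        exact hm (by linarith [hc.eq_one hin])
  exact hi n le_rfl

/-- If the first terms of two sequences differ by one and the larger one is followed by `1^[r-1]`,
a flip makes the first terms agree. -/
lemma length_eq_of_prefix {q n : ℕ} (hq : q = 2 * (n + 2)) {b c : List ℤ} {β : ℤ}
    (ih : ∀ d : List ℤ, d.length = c.length → Reduced n d.tail → value q b = value q d →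
      b.length = d.length)
    (hc : Reduced n c) (hp : List.replicate (n + 1) 1 <+: c)
    (hv : value q (β :: b) = value q ((β + 1) :: c)) : b.length = c.length := by
  obtain ⟨t, rfl⟩ := hp
  rw [value_flip (j := n + 1) (k := n + 1) (by omega) (by omega), add_sub_cancel_right] at hv
  have hlen : (List.replicate (n + 1) (-1) ++ decHead t).length =
      (List.replicate (n + 1) (1 : ℤ) ++ t).length := by
    simp [length_decHead]
  rw [ih _ hlen ?_ (step_injective q β hv), hlen]
  exact hc.flip

lemma length_eq_of_value_eq {q n : ℕ} (hq : q = 2 * (n + 2)) (b c : List ℤ)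
    (hb : Reduced n b.tail) (hc : Reduced n c.tail) (hv : value q b = value q c) :
    b.length = c.length := by
  induction hN : b.length + c.length using Nat.strong_induction_on generalizing b c with
  | _ N ih =>
  cases b with
  | nil =>
    cases c with
    | nil => rfl
    | cons γ c => rw [value_cons_eq hq (l := c) hc] at hv; exact absurd hv (OnePoint.infty_ne_coe _)
  | cons β b =>
    cases c with
    | nil => rw [value_cons_eq hq (l := b) hb] at hv; exact absurd hv (OnePoint.coe_ne_infty _)
    | cons γ c =>
      simp only [List.tail_cons] at hb hc
      simp only [List.length_cons] at hN ⊢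
      congr 1
      have hlam := one_lt_lam (show 4 ≤ q by omega)
      -- By symmetry it suffices to treat the case where the first terms differ by one.
      have key : ∀ (β : ℤ) (b c : List ℤ), b.length + 1 + (c.length + 1) = N →
          Reduced n b → Reduced n c → value q (β :: b) = value q ((β + 1) :: c) →
          b.length = c.length := by
        intro β b c hN hb hc hv
        have hr := hv
        rw [value_cons_eq hq hb, value_cons_eq hq hc, OnePoint.coe_eq_coe] at hr
        push_cast at hr
        by_cases h : lam q / 2 ≤ recip q c
        · exact length_eq_of_prefix hq
            (fun d hd hdr hbd => ih _ (by omega) b d hb.tail hdr hbd rfl) hc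
            (replicate_prefix_of_recip hq hc h) hv
        -- Equality of the values reads `recip c - recip b = λ`.
        · have h' : lam q / 2 ≤ recip q (negList b) := by
            rw [recip_negList]
            linarith
          have hv' := value_negList_congr hv
          rw [negList_cons, negList_cons, show -β = -(β + 1) + 1 by ring] at hv'
          have := length_eq_of_prefix hq
            (fun d hd hdr hbd => ih _ (by simp at hd ⊢; omega) (negList c) d hc.negList.tail hdr
              hbd rfl) hb.negList (replicate_prefix_of_recip hq hb.negList h') hv'.symm
          simpa using this.symm
      have hr := hv
      rw [value_cons_eq hq hb, value_cons_eq hq hc, OnePoint.coe_eq_coe] at hr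
      have h1 := abs_le.mp (abs_recip_le hq hb)
      have h2 := abs_le.mp (abs_recip_le hq hc)
      have hlt : ∀ d : ℤ, d * lam q ≤ 2 → d < 2 := by
        intro d hd
        by_contra h
        have : (2 : ℝ) ≤ d := by exact_mod_cast not_lt.mp h
        nlinarith
      have h3 := hlt (β - γ) (by push_cast; linarith)
      have h4 := hlt (γ - β) (by push_cast; linarith)
      rcases (by omega : γ = β ∨ γ = β + 1 ∨ β = γ + 1) with rfl | rfl | rfl
      · exact ih _ (by omega) b c hb.tail hc.tail (step_injective q _ hv) rfl
      · exact key β b c hN hb hc hv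
      · exact (key γ c b (by omega) hc hb hv.symm).symm

/-- Any sequence can be shortened to a reduced one of the same value, and those all have the same
length. -/
lemma isGeodesic_iff_reduced {q n : ℕ} (hq : q = 2 * (n + 2)) (b : List ℤ) :
    IsGeodesic q b ↔ Reduced n b.tail := by
  refine ⟨fun h => h.reduced_tail hq, fun hb => ?_⟩
  intro c
  induction hN : c.length using Nat.strong_induction_on generalizing c with
  | _ N ih =>
  intro hc
  by_cases hr : Reduced n c.tail
  · rw [length_eq_of_value_eq hq b c hb hr hc.symm, hN]
  · cases c with
    | nil => exact absurd trivial hr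
    | cons a l =>
      obtain ⟨d, hd, hv⟩ := exists_shorter_of_not_reduced hq hr a
      exact (ih _ (hN ▸ hd) d rfl (hv.trans hc)).trans (hN ▸ hd.le)

/-! ### Forbidden blocks -/

lemma longBlock_eq (n k : ℕ) :
    longBlock (n + 2) k = 1 :: (List.replicate n 1 ++ 2 ::
      ((List.replicate k (List.replicate n 1 ++ [2])).flatten ++ List.replicate (n + 1) 1)) := by
  simp [longBlock, List.replicate_succ]

lemma critical_flatten (n k : ℕ) :
    Critical n
      ((List.replicate k (List.replicate n 1 ++ [2])).flatten ++ List.replicate (n + 1) 1) := by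
  induction k with
  | zero => simpa using Critical.ones (n := n) []
  | succ k ih =>
    rw [List.replicate_succ, List.flatten_cons]
    simpa using Critical.two _ ih

lemma Critical.exists_prefix {n : ℕ} {l : List ℤ} (h : Critical n l) :
    ∃ k : ℕ, (List.replicate k (List.replicate n 1 ++ [2])).flatten ++ List.replicate (n + 1) 1
      <+: l := by
  induction h with
  | ones l => exact ⟨0, by simp⟩
  | two l _ ih =>
    obtain ⟨k, s, rfl⟩ := ih
    exact ⟨k + 1, s, by simp [List.replicate_succ]⟩

lemma Critical.exists_block {n : ℕ} {l : List ℤ} (h : Critical n l) :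
    List.replicate (n + 2) 1 <+: 1 :: l ∨ ∃ k, longBlock (n + 2) k <+: 1 :: l := by
  cases h with
  | ones l => exact .inl ⟨l, rfl⟩
  | two l h =>
    obtain ⟨k, s, rfl⟩ := h.exists_prefix
    exact .inr ⟨k, s, by simp [longBlock_eq]⟩

lemma Reduced.not_containsPM {n : ℕ} {l x : List ℤ} (h : Reduced n l) (hx : Critical n x) :
    ¬ ContainsPM l (1 :: x) := by
  have key : ∀ l, Reduced n l → ¬ (1 :: x) <:+: l := by
    rintro _ h ⟨p, s, rfl⟩
    rw [List.append_assoc] at h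
    exact h.of_append.2.1 ⟨rfl, hx.append s⟩
  rintro (H | H)
  · exact key l h H
  · refine key _ h.negList ?_
    have h2 : Rosen.negList (Rosen.negList (1 :: x)) <:+: Rosen.negList l := H.map (fun t => -t)
    rwa [negList_negList] at h2

/-- The recursive description of reduced sequences agrees with the one by forbidden blocks. -/
lemma reduced_iff (n : ℕ) (l : List ℤ) :
    Reduced n l ↔ (∀ x ∈ l, x ≠ 0) ∧ ¬ ContainsPM l (List.replicate (n + 2) 1) ∧
      ∀ k : ℕ, ¬ ContainsPM l (longBlock (n + 2) k) := by
  constructor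
  · refine fun h => ⟨?_, ?_, fun k => ?_⟩
    · intro x hx
      obtain ⟨s, t, rfl⟩ := List.append_of_mem hx
      exact (h.of_append : Reduced n (x :: t)).1
    · exact h.not_containsPM (x := List.replicate (n + 1) 1) (by simpa using Critical.ones (n := n) [])
    · rw [longBlock_eq]
      exact h.not_containsPM (.two _ (critical_flatten n k))
  · intro h
    induction l with
    | nil => trivial
    | cons a l ih =>
      obtain ⟨h0, h1, h2⟩ := h
      have hmono : ∀ x, ContainsPM l x → ContainsPM (a :: l) x := fun x hx =>
        hx.imp (List.IsInfix.trans · (List.suffix_cons a l).isInfix)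
          (List.IsInfix.trans · (List.suffix_cons a l).isInfix)
      refine ⟨h0 a (by simp), ?_, ?_, ih ⟨fun x hx => h0 x (by simp [hx]),
        fun H => h1 (hmono _ H), fun k H => h2 k (hmono _ H)⟩⟩
      · rintro ⟨rfl, hc⟩
        rcases hc.exists_block with H | ⟨k, H⟩
        · exact h1 (.inl H.isInfix)
        · exact h2 k (.inl H.isInfix)
      · rintro ⟨rfl, hc⟩
        have e : (1 :: negList l).map (fun t => -t) = -1 :: l := by
          simp [negList]
        rcases hc.exists_block with H | ⟨k, H⟩
        · exact h1 (.inr (e ▸ (H.map (fun t => -t)).isInfix))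
        · exact h2 k (.inr (e ▸ (H.map (fun t => -t)).isInfix))

end Rosen

theorem theorem3 (q r : ℕ) (hr : 2 ≤ r) (hq : q = 2 * r) (b : List ℤ) :
    Rosen.IsGeodesic q b ↔
      (∀ x ∈ b.tail, x ≠ 0) ∧
      ¬ Rosen.ContainsPM b.tail (List.replicate r 1) ∧
      ∀ k : ℕ, ¬ Rosen.ContainsPM b.tail (Rosen.longBlock r k) := by
  obtain ⟨n, rfl⟩ := Nat.exists_eq_add_of_le' hr
  rw [Rosen.isGeodesic_iff_reduced hq, Rosen.reduced_iff]
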